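/- **Setting.** There are $N$ files $W_1,\dots,W_N$ of $F$ independent uniform bits each, and $K$ users with independent requests; file $n$ is requested with probability $p_n$, where $p_1\ge\dots\ge p_N\ge 0$ and $\sum_n p_n=1$. Before the demands are known, each user stores, uncoded, at most $MF$ bits of the files ($M\ge 0$). For every demand vector $d=(d_1,\dots,d_K)$ the server broadcasts a message of some length $\ell_d$ bits, an arbitrary function of the files, from which, together with its own cache content, user $k$ must recover $W_{d_k}$ by an arbitrary decoding function. The average rate is $\bar R=\sum_{d}\prod_{k=1}^K p_{d_k}\,\ell_d/F$. For a placement let $W_{n,S}$ be the part of $W_n$ stored by exactly the users in $S\subseteq\{1,\dots,K\}$, and let $a_{n,l}=\binom{K}{l}^{-1}\sum_{|S|=l}|W_{n,S}|/F$, $0\le l\le K$ (if the size of $W_{n,S}$ depends on $S$ only through $|S|$, then $a_{n,l}=|W_{n,S}|/F$ for every $S$ with $|S|=l$). Let $\mathcal Q$ be the set of popularity-first vectors $a=(a_{n,l})$, that is, $a_{n,l}\ge a_{n+1,l}$ for $1\le n<N$ and $1\le l\le K$. A placement is popularity-first if its vector lies in $\mathcal Q$. For $\mathcal D\subseteq\{1,\dots,N\}$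 and a bijection $\pi:\{1,\dots,|\mathcal D|\}\to\mathcal D$ put $$r(\mathcal D,\pi;a)=\sum_{l=0}^{K-1}\sum_{i=1}^{|\mathcal D|}\binom{K-i}{l}a_{\pi(i),l},$$ and let $\phi=\phi_{\mathcal D}$ be the bijection that lists $\mathcal D$ by increasing index, hence in decreasing order of popularity, $p_{\phi(1)}\ge p_{\phi(2)}\ge\cdots$. Consider the optimization problem $$\textbf{P2}:\quad \min_{a\in\mathcal Q}\ \bar R_{\rm lb}(a)=\sum_{\mathcal D\subseteq\{1,\dots,N\}}\ \sum_{d:\,\{d_1,\dots,d_K\}=\mathcal D}\ \prod_{k=1}^K p_{d_k}\; r(\mathcal D,\phi_{\mathcal D};a)$$ subject to $\sum_{l=0}^K\binom Kl a_{n,l}=1$ for all $n$, $\ \sum_{n=1}^N\sum_{l=1}^K\binom{K-1}{l-1}a_{n,l}\le M$, and $a_{n,l}\ge 0$. **Lemma 2.** (i) For every $a\in\mathcal Q$ and every $\mathcal D$ with $|\mathcal D|\le K$, $\max_\pi r(\mathcal D,\pi;a)=r(\mathcal D,\phi_{\mathcal D};a)$, the maximum being over all bijections $\pi:\{1,\dots,|\mathcal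 D|\}\to\mathcal D$. (ii) The minimum in P2 exists, and it is a lower bound on the average rate under popularity-first uncoded placement: every scheme with popularity-first placement in which each user always recovers its file has a vector $a$ that is feasible for P2, and its average rate satisfies $\bar R\ge\bar R_{\rm lb}(a)\ge\min\textbf{P2}$. The same bound $R\ge\min\textbf{P2}$ holds for every $R$ that is achievable with vanishing error, i.e. such that for each $\varepsilon>0$ there is, for some $F\ge 1$, a scheme with popularity-first placement whose probability that some user fails is at most $\varepsilon$ for every demand vector and whose average rate is at most $R+\varepsilon$. -/

import Mathlib

namespace UncodedCaching

/-- A realization of the `N` files, each of `F` bits. -/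
abbrev Files (N F : ℕ) : Type := Fin N → Fin F → Bool

/-- A caching scheme with uncoded placement for `N` files of `F` bits and `K` users.
User `k` stores the file bits at the positions `cached k`, uncoded and independently of the
demands. For each demand vector `d` the server broadcasts a message of `len d` bits, which may be
any function of all files, and user `k` forms its estimate of file `d k` from the message and from
its own cache content by an arbitrary function. -/
structure Scheme (N K F : ℕ) where
  /-- the bit positions (file, index in the file) stored by each user -/
  cached : Fin K → Finset (Fin N × Fin F)
  /-- the number of bits broadcast for each demand vector -/
  len : (Fin K → Fin N) → ℕ
  /-- the broadcast message for each demand vector -/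
  encode : (d : Fin K → Fin N) → Files N F → (Fin (len d) → Bool)
  /-- the estimate that a user forms of its requested file -/
  decode : (d : Fin K → Fin N) → (k : Fin K) → (Fin (len d) → Bool) →
    ({x : Fin N × Fin F // x ∈ cached k} → Bool) → (Fin F → Bool)

namespace Scheme

variable {N K F : ℕ}

/-- Each user stores at most `M * F` bits. -/
def MeetsMemory (s : Scheme N K F) (M : ℝ) : Prop :=
  ∀ k, ((s.cached k).card : ℝ) ≤ M * F

/-- The subfile `W_{n,S}`: the bits of file `n` stored by exactly the users in `S`. -/
def subfile (s : Scheme N K F) (n : Fin N) (S : Finset (Fin K)) : Finset (Fin F) :=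
  Finset.univ.filter fun b => ∀ k, (n, b) ∈ s.cached k ↔ k ∈ S

/-- The numbers `a_{n,l}`: the size of a subfile `W_{n,S}` with `|S| = l`, as a fraction of the
file size, averaged over the `K.choose l` user subsets `S` of size `l`. When the size of `W_{n,S}`
depends on `S` only through `|S|`, this is the common value `|W_{n,S}| / F`. -/
noncomputable def frac (s : Scheme N K F) (n : Fin N) (l : Fin (K + 1)) : ℝ :=
  (∑ S ∈ Finset.powersetCard (l : ℕ) (Finset.univ : Finset (Fin K)),
    ((s.subfile n S).card : ℝ) / F) / (K.choose l : ℝ)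

/-- The cache content of user `k`. -/
def cacheContent (s : Scheme N K F) (W : Files N F) (k : Fin K) :
    {x : Fin N × Fin F // x ∈ s.cached k} → Bool :=
  fun x => W x.1.1 x.1.2

/-- User `k` recovers its requested file, for the demand vector `d` and the files `W`. -/
def Recovers (s : Scheme N K F) (d : Fin K → Fin N) (W : Files N F) (k : Fin K) : Prop :=
  s.decode d k (s.encode d W) (s.cacheContent W k) = W (d k)

/-- Every user always recovers its requested file. -/
def ZeroError (s : Scheme N K F) : Prop :=
  ∀ d W k, s.Recovers d W k

open Classical in
/-- The probability that some user fails to recover its requested file under the demand vector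
`d`, the file bits being independent and uniform. -/
noncomputable def errorProb (s : Scheme N K F) (d : Fin K → Fin N) : ℝ :=
  ((Finset.univ.filter fun W : Files N F => ∃ k, ¬ s.Recovers d W k).card : ℝ) /
    (Fintype.card (Files N F) : ℝ)

/-- The average rate: the expected message length in units of the file size, when the users'
requests are independent with distribution `p`. -/
noncomputable def avgRate (s : Scheme N K F) (p : Fin N → ℝ) : ℝ :=
  ∑ d : Fin K → Fin N, (∏ k, p (d k)) * ((s.len d : ℝ) / F)

end Scheme

/-- The set `Q` of popularity-first placement vectors: `a_{n,l} ≥ a_{n+1,l}` for `1 ≤ l ≤ K`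
(there is no condition for `l = 0`). -/
def PopularityFirst {N K : ℕ} (a : Fin N → Fin (K + 1) → ℝ) : Prop :=
  ∀ l : Fin K, ∀ n m : Fin N, (n : ℕ) + 1 = m → a m l.succ ≤ a n l.succ

/-- The file partition, cache memory and nonnegativity constraints on a placement vector. In the
memory constraint the index `l : Fin K` stands for the subset size `l + 1`. -/
structure IsPlacement {N K : ℕ} (M : ℝ) (a : Fin N → Fin (K + 1) → ℝ) : Prop where
  partition : ∀ n, ∑ l : Fin (K + 1), (K.choose l : ℝ) * a n l = 1
  memory : ∑ n, ∑ l : Fin K, ((K - 1).choose l : ℝ) * a n l.succ ≤ M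
  nonneg : ∀ n l, 0 ≤ a n l

/-- `∑_{l=0}^{K-1} ∑_{i=1}^{|D|} (K-i choose l) a_{π(i),l}`, where `i : Fin D.card` stands for
the position `i + 1`. -/
noncomputable def orderedSum {N K : ℕ} (a : Fin N → Fin (K + 1) → ℝ) (D : Finset (Fin N))
    (π : Fin D.card ≃ D) : ℝ :=
  ∑ l : Fin K, ∑ i : Fin D.card,
    ((K - ((i : ℕ) + 1)).choose l : ℝ) * a (π i) l.castSucc

/-- The bound for the distinct file set `D` under a general placement: the maximum of `orderedSum`
over all bijections. -/
noncomputable def rateLbMax {N K : ℕ} (a : Fin N → Fin (K + 1) → ℝ) (D : Finset (Fin N)) : ℝ :=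
  (Finset.univ : Finset (Fin D.card ≃ D)).sup'
    ⟨D.equivFin.symm, Finset.mem_univ _⟩ (orderedSum a D)

/-- The bijection `φ` that lists the files of `D` by increasing label; labels are assigned in
decreasing order of popularity. -/
def phi {N : ℕ} (D : Finset (Fin N)) : Fin D.card ≃ D :=
  (D.orderIsoOfFin rfl).toEquiv

/-- The bound for the distinct file set `D` under a popularity-first placement. -/
noncomputable def rateLb {N K : ℕ} (a : Fin N → Fin (K + 1) → ℝ) (D : Finset (Fin N)) : ℝ :=
  orderedSum a D (phi D)

/-- `T(D)`: the demand vectors whose set of distinct entries is `D`. -/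
def demandsOf {N : ℕ} (K : ℕ) (D : Finset (Fin N)) : Finset (Fin K → Fin N) :=
  Finset.univ.filter fun d => Finset.univ.image d = D

/-- The objective of the problem P2. -/
noncomputable def avgRateLb {N K : ℕ} (p : Fin N → ℝ) (a : Fin N → Fin (K + 1) → ℝ) : ℝ :=
  ∑ D ∈ (Finset.univ : Finset (Fin N)).powerset, ∑ d ∈ demandsOf K D,
    (∏ k, p (d k)) * rateLb a D

/-- The feasible set of the problem P2. -/
def p2Feasible (N K : ℕ) (M : ℝ) : Set (Fin N → Fin (K + 1) → ℝ) :=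
  {a | PopularityFirst a ∧ IsPlacement M a}

/-- The optimal value of the problem P2. -/
noncomputable def p2Value {N : ℕ} (K : ℕ) (p : Fin N → ℝ) (M : ℝ) : ℝ :=
  sInf (avgRateLb p '' p2Feasible N K M)

/-- The average rate `R` is achievable, with error probability tending to zero, by schemes with
uncoded popularity-first placement and cache size `M`. -/
def Achievable {N : ℕ} (K : ℕ) (p : Fin N → ℝ) (M R : ℝ) : Prop :=
  ∀ ε : ℝ, 0 < ε → ∃ F : ℕ, 0 < F ∧ ∃ s : Scheme N K F,
    s.MeetsMemory M ∧ PopularityFirst s.frac ∧ (∀ d, s.errorProb d ≤ ε) ∧ s.avgRate p ≤ R + ε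

end UncodedCaching

open UncodedCaching

namespace UncodedCaching

open Finset

/-! Part (i) is the rearrangement inequality: for each `l` the coefficients decrease with the
position, and so do the entries along `φ`. For the converse, choose one user per distinct requested
file, in the order `φ`. An index coding bound makes the message at least as long as the bits of the
`i`-th file stored by none of the first `i` chosen users (`sum_card_le_len`). Subfile sizes may
depend on more than `|S|`, so this is averaged over all relabellings of the users: a bit with `l`
storers is then counted with weight `(K-i choose l)/(K choose l)`, which gives exactly `rateLb` at
the averaged vector (`rateLb_mul_le_sum_len`). Independent, identically distributed requests make
the average rate invariant under relabelling. The index coding bound only needs error below `1/2`,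
so vanishing error requires no limiting entropy argument. The minimum exists by compactness. -/

/-! ### Counting permutations that avoid a set -/

/-- The number of permutations that move a set `U` off a set `S` depends only on the cardinality
of `S`. -/
lemma card_perm_avoiding_eq {α : Type*} [Fintype α] [DecidableEq α] (U : Finset α)
    {S S' : Finset α} (h : #S = #S') :
    #{τ : Equiv.Perm α | ∀ x ∈ U, τ x ∉ S} = #{τ : Equiv.Perm α | ∀ x ∈ U, τ x ∉ S'} := by
  let e : {x // x ∈ S} ≃ {x // x ∈ S'} := Finset.equivOfCardEq h
  let ρ : Equiv.Perm α := e.extendSubtype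
  have hρ : ∀ x, ρ x ∈ S' ↔ x ∈ S := fun x =>
    ⟨fun hx => by_contra fun hn => e.extendSubtype_not_mem x hn hx,
      fun hx => e.extendSubtype_mem x hx⟩
  refine Finset.card_equiv (Equiv.mulLeft ρ) fun τ => ?_
  simp [hρ]

/-- The proportion of permutations that move a set `U` off a set `S`. -/
lemma card_perm_avoiding_mul_choose {α : Type*} [Fintype α] [DecidableEq α] (U S : Finset α) :
    #{τ : Equiv.Perm α | ∀ x ∈ U, τ x ∉ S} * (Fintype.card α).choose #S =
      (Fintype.card α).factorial * (Fintype.card α - #U).choose #S := by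
  -- Double count the pairs `(S', τ)` with `#S' = #S`: by symmetry every `S'` contributes equally.
  have h1 : ∑ S' ∈ powersetCard #S (univ : Finset α),
      #{τ : Equiv.Perm α | ∀ x ∈ U, τ x ∉ S'} =
        #{τ : Equiv.Perm α | ∀ x ∈ U, τ x ∉ S} * (Fintype.card α).choose #S := by
    rw [sum_congr rfl fun S' hS' =>
      card_perm_avoiding_eq U (S' := S) (mem_powersetCard.1 hS').2]
    simp [mul_comm]
  have h2 : ∑ S' ∈ powersetCard #S (univ : Finset α),
      #{τ : Equiv.Perm α | ∀ x ∈ U, τ x ∉ S'} =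
        ∑ τ : Equiv.Perm α, #{S' ∈ powersetCard #S (univ : Finset α) | ∀ x ∈ U, τ x ∉ S'} :=
    sum_card_bipartiteAbove_eq_sum_card_bipartiteBelow
      (fun (S' : Finset α) (τ : Equiv.Perm α) => ∀ x ∈ U, τ x ∉ S')
  have h3 : ∀ τ : Equiv.Perm α,
      #{S' ∈ powersetCard #S (univ : Finset α) | ∀ x ∈ U, τ x ∉ S'} =
        (Fintype.card α - #U).choose #S := by
    intro τ
    have : {S' ∈ powersetCard #S (univ : Finset α) | ∀ x ∈ U, τ x ∉ S'} =
        powersetCard #S (U.image τ)ᶜ := by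
      ext S'
      simp only [mem_filter, mem_powersetCard, subset_iff, mem_compl,
        mem_image, not_exists, not_and]
      constructor
      · rintro ⟨⟨-, hc⟩, h⟩
        exact ⟨fun y hy x hx e => h x hx (e ▸ hy), hc⟩
      · rintro ⟨h, hc⟩
        exact ⟨⟨fun _ _ => mem_univ _, hc⟩, fun x hx hy => h hy x hx rfl⟩
    rw [this, card_powersetCard, card_compl, card_image_of_injective _ τ.injective]
  rw [← h1, h2, sum_congr rfl fun τ _ => h3 τ]
  simp [Fintype.card_perm]

/-! ### Rate bounds for a single scheme -/

namespace Scheme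

variable {N K F : ℕ}

/-- The users that store the bit at position `x`. -/
def storers (s : Scheme N K F) (x : Fin N × Fin F) : Finset (Fin K) := {k | x ∈ s.cached k}

lemma mem_storers {s : Scheme N K F} {x : Fin N × Fin F} {k : Fin K} :
    k ∈ s.storers x ↔ x ∈ s.cached k := by simp [storers]

/-- The index coding bound: take users `u 0, u 1, …` with distinct requests, and for each of them
count the bits of its requested file that neither it nor any earlier user stores. If all users
succeed with probability more than `1 / 2`, the message has at least that many bits. -/
lemma sum_card_le_len (s : Scheme N K F) (d : Fin K → Fin N) (herr : s.errorProb d < 1 / 2)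
    {m : ℕ} (u : Fin m → Fin K) (hu : Function.Injective (d ∘ u)) :
    ∑ i, #{b : Fin F | ∀ j ≤ i, u j ∉ s.storers (d (u i), b)} ≤ s.len d := by
  classical
  let T : Finset (Fin N × Fin F) := {x | ∃ i, d (u i) = x.1 ∧ ∀ j ≤ i, u j ∉ s.storers x}
  have hT : ∑ i, #{b : Fin F | ∀ j ≤ i, u j ∉ s.storers (d (u i), b)} ≤ #T := by
    rw [← card_sigma]
    refine card_le_card_of_injOn (fun y => (d (u y.1), y.2)) ?_ ?_
    · rintro ⟨i, b⟩ h
      simp only [coe_sigma, Set.mem_sigma_iff, mem_coe, mem_filter, mem_univ, true_and] at h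
      simp only [T, mem_coe, mem_filter, mem_univ, true_and]
      exact ⟨i, rfl, h⟩
    · rintro ⟨i, b⟩ - ⟨i', b'⟩ - h
      simp only [Prod.mk.injEq] at h
      obtain rfl := hu h.1
      simp [h.2]
  refine hT.trans ?_
  by_contra! hlt
  let G : Finset (Files N F) := {W | ∀ k, s.Recovers d W k}
  -- On successful realizations, the message and the bits outside `T` determine all files.
  let g : Files N F → (Fin (s.len d) → Bool) × ({x : Fin N × Fin F // x ∈ Tᶜ} → Bool) :=
    fun W => (s.encode d W, fun x => W x.1.1 x.1.2)
  have hinj : Set.InjOn g G := by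
    intro W hW W' hW' h
    simp only [G, coe_filter, mem_univ, true_and, Set.mem_ofPred_eq] at hW hW'
    obtain ⟨hm, hc⟩ := Prod.mk.inj h
    have hout : ∀ n b, (n, b) ∉ T → W n b = W' n b := fun n b hx =>
      congrFun hc ⟨(n, b), mem_compl.2 hx⟩
    have hreq : ∀ i, W (d (u i)) = W' (d (u i)) := by
      intro i
      induction i using WellFoundedLT.induction with
      | _ i ih =>
        have hcache : s.cacheContent W (u i) = s.cacheContent W' (u i) := by
          ext ⟨⟨n, b⟩, hx⟩
          simp only [cacheContent]
          -- A cached bit lying in `T` belongs to a file requested by an earlier user, hence already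
          -- decoded.
          by_cases hT' : (n, b) ∈ T
          · obtain ⟨j, hj, hj'⟩ := (mem_filter.1 hT').2
            simp only at hj
            have hji : j < i := not_le.1 fun h => hj' i h (mem_storers.2 hx)
            rw [← hj, ih j hji]
          · exact hout n b hT'
        rw [← hW (u i), ← hW' (u i), hcache, hm]
    ext n b
    by_cases hx : (n, b) ∈ T
    · obtain ⟨i, hi, -⟩ := (mem_filter.1 hx).2
      simp only at hi
      rw [← hi, hreq]
    · exact hout n b hx
  have hG : #G ≤ 2 ^ s.len d * 2 ^ #Tᶜ := by
    have := card_le_card_of_injOn g (fun _ _ => mem_coe.2 (mem_univ _)) hinj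
    simpa [-mem_compl] using this
  have htot : Fintype.card (Files N F) = 2 ^ #T * 2 ^ #Tᶜ := by
    rw [← pow_add, card_add_card_compl]
    simp [← pow_mul, mul_comm]
  -- One missing message bit already halves the number of realizations that can succeed.
  have h2G : 2 * #G ≤ Fintype.card (Files N F) := by
    calc 2 * #G ≤ 2 * (2 ^ s.len d * 2 ^ #Tᶜ) := by gcongr
      _ = 2 ^ (s.len d + 1) * 2 ^ #Tᶜ := by ring
      _ ≤ 2 ^ #T * 2 ^ #Tᶜ := by gcongr <;> omega
      _ = _ := htot.symm
  have hbad : #{W : Files N F | ∃ k, ¬ s.Recovers d W k} + #G = Fintype.card (Files N F) := by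
    have := card_filter_add_card_filter_not (s := (univ : Finset (Files N F)))
      (fun W => ∃ k, ¬ s.Recovers d W k)
    simpa [G] using this
  have hpos : (0 : ℝ) < Fintype.card (Files N F) := by
    exact_mod_cast Fintype.card_pos
  rw [errorProb, div_lt_iff₀ hpos] at herr
  have hbad' : (#{W : Files N F | ∃ k, ¬ s.Recovers d W k} : ℝ) + #G =
    Fintype.card (Files N F) := by exact_mod_cast hbad
  have h2G' : 2 * (#G : ℝ) ≤ Fintype.card (Files N F) := by exact_mod_cast h2G
  have herr' : (#{W : Files N F | ∃ k, ¬ s.Recovers d W k} : ℝ) <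
    1 / 2 * Fintype.card (Files N F) := by convert herr
  linarith

lemma choose_mul_frac (s : Scheme N K F) (n : Fin N) (l : Fin (K + 1)) :
    (K.choose l : ℝ) * s.frac n l = (#{b | #(s.storers (n, b)) = l} : ℝ) / F := by
  have hK : (K.choose l : ℝ) ≠ 0 := by
    exact_mod_cast (Nat.choose_pos (Nat.lt_succ_iff.1 l.2)).ne'
  have h : #{b | #(s.storers (n, b)) = l} =
      ∑ S ∈ powersetCard (l : ℕ) univ, #(s.subfile n S) := by
    rw [card_eq_sum_card_fiberwise (f := fun b => s.storers (n, b))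
      (t := powersetCard (l : ℕ) univ) (fun b hb => by simpa using hb)]
    refine sum_congr rfl fun S hS => ?_
    congr 1
    ext b
    simp only [mem_filter, mem_univ, true_and, subfile, ← mem_storers, ← Finset.ext_iff]
    exact ⟨fun h => h.2, fun h => ⟨h ▸ (mem_powersetCard.1 hS).2, h⟩⟩
  rw [frac, mul_div_cancel₀ _ hK, ← sum_div, h, Nat.cast_sum]

/-- Weighted sums of the numbers `a_{n,l}` as sums over the bits of file `n`. -/
lemma sum_mul_frac (s : Scheme N K F) (n : Fin N) (w : ℕ → ℝ) :
    ∑ l : Fin (K + 1), w l * ((K.choose l : ℝ) * s.frac n l) =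
      (∑ b, w #(s.storers (n, b))) / F := by
  have hcard : ∀ b, #(s.storers (n, b)) < K + 1 := fun b =>
    Nat.lt_succ_of_le ((card_le_univ _).trans (by simp))
  simp only [choose_mul_frac, ← mul_div_assoc, ← sum_div]
  congr 1
  rw [← sum_fiberwise univ (fun b => (⟨#(s.storers (n, b)), hcard b⟩ : Fin (K + 1)))]
  refine sum_congr rfl fun l _ => ?_
  rw [sum_congr rfl (g := fun _ => w l) (fun b hb => by
    rw [← (mem_filter.1 hb).2]), sum_const, nsmul_eq_mul, mul_comm]
  simp only [Fin.ext_iff]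

/-- The binomial ratio hidden in `frac` is the proportion of user permutations moving `U` off a
storer set of size `l`, so the sum can be taken bit by bit. -/
lemma sum_choose_mul_frac_castSucc (s : Scheme N K F) (n : Fin N) {U : Finset (Fin K)}
    (hU : U.Nonempty) :
    ∑ l : Fin K, ((K - #U).choose l : ℝ) * s.frac n l.castSucc =
      (∑ b, (#{τ : Equiv.Perm (Fin K) | ∀ x ∈ U, τ x ∉ s.storers (n, b)} : ℝ)) /
        K.factorial / F := by
  have hK : 0 < K := Fin.pos hU.choose
  -- Since `U` is nonempty, the missing term `l = K` vanishes.
  have hlast : (K - #U).choose K = 0 :=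
    Nat.choose_eq_zero_of_lt (by have := hU.card_pos; omega)
  have h := s.sum_mul_frac n fun l => ((K - #U).choose l : ℝ) / K.choose l
  have hterm : ∀ l : Fin (K + 1), ((K - #U).choose l : ℝ) / K.choose l *
      ((K.choose l : ℝ) * s.frac n l) = ((K - #U).choose l : ℝ) * s.frac n l := by
    intro l
    have hc : (K.choose l : ℝ) ≠ 0 := by
      exact_mod_cast (Nat.choose_pos (Nat.lt_succ_iff.1 l.2)).ne'
    field_simp
  simp only [hterm, Fin.sum_univ_castSucc, Fin.val_castSucc, Fin.val_last, hlast,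
    Nat.cast_zero, zero_mul, add_zero] at h
  rw [h]
  congr 1
  rw [sum_div]
  refine sum_congr rfl fun b _ => ?_
  have hc : (K.choose #(s.storers (n, b)) : ℝ) ≠ 0 := by
    exact_mod_cast (Nat.choose_pos ((card_le_univ _).trans (by simp))).ne'
  have hcount := card_perm_avoiding_mul_choose U (s.storers (n, b))
  rw [Fintype.card_fin] at hcount
  rw [div_eq_div_iff hc (by positivity)]
  rw [mul_comm]
  norm_cast
  convert hcount.symm

/-- The memory constraint is the average over the users of their individual cache limits. -/
lemma isPlacement_frac (s : Scheme N K F) (hF : 0 < F) {M : ℝ} (hM : 0 ≤ M)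
    (hs : s.MeetsMemory M) : IsPlacement M s.frac where
  partition n := by
    have h := s.sum_mul_frac n fun _ => 1
    have hF' : (F : ℝ) ≠ 0 := by positivity
    simpa [hF'] using h
  memory := by
    rcases Nat.eq_zero_or_pos K with rfl | hK
    · simpa using hM
    obtain ⟨k, rfl⟩ : ∃ k, K = k + 1 := ⟨K - 1, by omega⟩
    have hfile : ∀ n, ∑ l : Fin (k + 1), ((k + 1 - 1).choose l : ℝ) * s.frac n l.succ =
        (∑ b, (#(s.storers (n, b)) : ℝ)) / (k + 1 : ℝ) / F := by
      intro n
      -- A bit with `l` storers fills `l / K` of a cache position on average.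
      have h := s.sum_mul_frac n fun l => (l : ℝ) / (k + 1)
      rw [Fin.sum_univ_succ] at h
      rw [sum_div, ← h]
      simp only [Fin.val_zero, Nat.cast_zero, zero_div, zero_mul, zero_add,
        Nat.add_sub_cancel]
      refine sum_congr rfl fun l _ => ?_
      have hc : ((k + 1 : ℕ) : ℝ) * k.choose l = (k + 1).choose (l + 1) * (l + 1 : ℕ) := by
        exact_mod_cast Nat.add_one_mul_choose_eq k l
      rw [← mul_assoc]
      congr 1
      rw [Fin.val_succ, div_mul_eq_mul_div, eq_div_iff (by positivity)]
      push_cast at hc ⊢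
      linarith
    have hcount : ∑ n, ∑ b, #(s.storers (n, b)) = ∑ j, #(s.cached j) := by
      rw [← Fintype.sum_prod_type']
      have := sum_card_bipartiteAbove_eq_sum_card_bipartiteBelow
        (s := (univ : Finset (Fin N × Fin F))) (t := (univ : Finset (Fin (k + 1))))
        (fun x j => x ∈ s.cached j)
      simpa [bipartiteAbove, bipartiteBelow, storers] using this
    have hsum : ∑ n, ∑ b, (#(s.storers (n, b)) : ℝ) ≤ (k + 1) * (M * F) := by
      have h := sum_le_sum fun j (_ : j ∈ univ) => hs j
      simp only [sum_const, card_univ, Fintype.card_fin, nsmul_eq_mul] at h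
      have hcount' : ∑ n, ∑ b, (#(s.storers (n, b)) : ℝ) = ∑ j, (#(s.cached j) : ℝ) := by
        exact_mod_cast hcount
      rw [hcount']
      exact_mod_cast h
    simp only [hfile, ← sum_div]
    rw [div_div, div_le_iff₀ (by positivity)]
    linarith
  nonneg n l := by
    unfold frac
    positivity

/-- The average message length over all reassignments of the requests to the users. -/
lemma rateLb_mul_le_sum_len (s : Scheme N K F) (hF : 0 < F)
    (herr : ∀ d, s.errorProb d < 1 / 2) (d : Fin K → Fin N) :
    rateLb s.frac (univ.image d) * (K.factorial * F) ≤
      ∑ τ : Equiv.Perm (Fin K), (s.len (d ∘ ⇑τ⁻¹) : ℝ) := by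
  set D := univ.image d
  have hex : ∀ i : Fin #D, ∃ k, d k = phi D i := fun i => by
    obtain ⟨k, -, hk⟩ := mem_image.1 (phi D i).2
    exact ⟨k, hk⟩
  choose u hu using hex
  have hdu : Function.Injective (d ∘ u) := fun i j h => by
    simp only [Function.comp_apply, hu] at h
    exact (phi D).injective (Subtype.ext h)
  have hui : Function.Injective u := hdu.of_comp
  have hU : ∀ i : Fin #D, #((Iic i).image u) = i + 1 := fun i => by
    rw [card_image_of_injective _ hui, Fin.card_Iic]
  have key : rateLb s.frac D * (K.factorial * F) =
      ∑ i : Fin #D, ∑ b, (#{τ : Equiv.Perm (Fin K) |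
        ∀ j ≤ i, τ (u j) ∉ s.storers (d (u i), b)} : ℝ) := by
    rw [rateLb, orderedSum, sum_comm, sum_mul]
    refine sum_congr rfl fun i _ => ?_
    have h := s.sum_choose_mul_frac_castSucc (phi D i) (U := (Iic i).image u) (by simp)
    rw [hU] at h
    rw [h, div_div, div_mul_cancel₀ _ (by positivity)]
    simp [hu]
  rw [key]
  have hswap : ∀ i : Fin #D, ∑ b, #{τ : Equiv.Perm (Fin K) |
      ∀ j ≤ i, τ (u j) ∉ s.storers (d (u i), b)} =
      ∑ τ : Equiv.Perm (Fin K), #{b | ∀ j ≤ i, τ (u j) ∉ s.storers (d (u i), b)} := fun i =>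
    sum_card_bipartiteAbove_eq_sum_card_bipartiteBelow
      (fun b (τ : Equiv.Perm (Fin K)) => ∀ j ≤ i, τ (u j) ∉ s.storers (d (u i), b))
  have hle : ∑ i : Fin #D, ∑ b, #{τ : Equiv.Perm (Fin K) |
      ∀ j ≤ i, τ (u j) ∉ s.storers (d (u i), b)} ≤
        ∑ τ : Equiv.Perm (Fin K), s.len (d ∘ ⇑τ⁻¹) := by
    simp only [hswap]
    rw [sum_comm]
    refine sum_le_sum fun τ _ => ?_
    -- Under `d ∘ τ⁻¹`, user `τ (u i)` requests the same file as `u i` does under `d`.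
    have h := s.sum_card_le_len (d ∘ ⇑τ⁻¹) (herr _) (⇑τ ∘ u)
      (by simpa [Function.comp_def] using hdu)
    simpa using h
  exact_mod_cast hle

lemma avgRateLb_eq_sum (p : Fin N → ℝ) (a : Fin N → Fin (K + 1) → ℝ) :
    avgRateLb p a = ∑ d : Fin K → Fin N, (∏ k, p (d k)) * rateLb a (univ.image d) := by
  rw [avgRateLb, powerset_univ, ← sum_fiberwise univ (fun d : Fin K → Fin N => univ.image d)]
  refine sum_congr rfl fun D _ => sum_congr rfl fun d hd => ?_
  rw [(mem_filter.1 hd).2]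

/-- The product weight of a demand vector is unchanged by permuting users. Popularity-first order
plays no role here. -/
lemma avgRateLb_frac_le_avgRate (s : Scheme N K F) (hF : 0 < F)
    (herr : ∀ d, s.errorProb d < 1 / 2) {p : Fin N → ℝ} (hp : ∀ n, 0 ≤ p n) :
    avgRateLb p s.frac ≤ s.avgRate p := by
  have hsym : ∀ τ : Equiv.Perm (Fin K),
      ∑ d : Fin K → Fin N, (∏ k, p (d k)) * (s.len (d ∘ ⇑τ⁻¹) : ℝ) =
        ∑ d : Fin K → Fin N, (∏ k, p (d k)) * (s.len d : ℝ) := by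
    intro τ
    refine Fintype.sum_equiv (Equiv.arrowCongr τ (Equiv.refl _)) _ _ fun d => ?_
    have hprod : ∏ k, p (d (τ⁻¹ k)) = ∏ k, p (d k) :=
      Equiv.prod_comp τ⁻¹ fun k => p (d k)
    rw [← hprod]
    rfl
  have hrate : s.avgRate p * (K.factorial * F) = ∑ d : Fin K → Fin N,
      (∏ k, p (d k)) * ∑ τ : Equiv.Perm (Fin K), (s.len (d ∘ ⇑τ⁻¹) : ℝ) := by
    simp only [mul_sum]
    rw [sum_comm, sum_congr rfl fun τ _ => hsym τ, sum_const, card_univ, Fintype.card_perm,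
      Fintype.card_fin, nsmul_eq_mul, avgRate]
    simp only [← mul_div_assoc, ← sum_div]
    field_simp
  have hpos : (0 : ℝ) < K.factorial * F := by positivity
  refine le_of_mul_le_mul_right ?_ hpos
  rw [hrate, avgRateLb_eq_sum, sum_mul]
  refine sum_le_sum fun d _ => ?_
  rw [mul_assoc]
  exact mul_le_mul_of_nonneg_left (s.rateLb_mul_le_sum_len hF herr d)
    (prod_nonneg fun k _ => hp _)

end Scheme

/-! ### Existence of the minimum -/

lemma avgRateLb_continuous {N K : ℕ} (p : Fin N → ℝ) :
    Continuous (avgRateLb p : (Fin N → Fin (K + 1) → ℝ) → ℝ) := by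
  unfold avgRateLb rateLb orderedSum
  fun_prop

lemma p2Feasible_isCompact (N K : ℕ) (M : ℝ) : IsCompact (p2Feasible N K M) := by
  refine (isCompact_univ_pi fun _ : Fin N => isCompact_univ_pi fun _ : Fin (K + 1) =>
    isCompact_Icc (a := (0 : ℝ)) (b := 1)).of_isClosed_subset ?_ ?_
  · have : p2Feasible N K M =
        {a | ∀ l : Fin K, ∀ n m : Fin N, (n : ℕ) + 1 = m → a m l.succ ≤ a n l.succ} ∩
        ({a | ∀ n, ∑ l : Fin (K + 1), (K.choose l : ℝ) * a n l = 1} ∩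
        ({a | ∑ n, ∑ l : Fin K, ((K - 1).choose l : ℝ) * a n l.succ ≤ M} ∩
        {a | ∀ n l, 0 ≤ a n l})) := by
      ext a
      exact ⟨fun h => ⟨h.1, h.2.1, h.2.2, h.2.3⟩, fun h => ⟨h.1, h.2.1, h.2.2.1, h.2.2.2⟩⟩
    rw [this]
    simp only [Set.ofPred_forall]
    refine IsClosed.inter ?_ (IsClosed.inter ?_ (IsClosed.inter ?_ ?_))
    · exact isClosed_iInter fun l => isClosed_iInter fun n => isClosed_iInter fun m =>
        isClosed_iInter fun _ => isClosed_le (by fun_prop) (by fun_prop)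
    · exact isClosed_iInter fun n => isClosed_eq (by fun_prop) (by fun_prop)
    · exact isClosed_le (by fun_prop) (by fun_prop)
    · exact isClosed_iInter fun n => isClosed_iInter fun l =>
        isClosed_le (by fun_prop) (by fun_prop)
  · rintro a ⟨-, h⟩ n - l -
    refine ⟨h.nonneg n l, ?_⟩
    have h1 : (K.choose l : ℝ) * a n l ≤ 1 := by
      rw [← h.partition n]
      exact single_le_sum (f := fun l : Fin (K + 1) => (K.choose l : ℝ) * a n l)
        (fun l _ => mul_nonneg (Nat.cast_nonneg _) (h.nonneg n l)) (mem_univ l)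
    have h2 : (1 : ℝ) ≤ K.choose l := by
      exact_mod_cast Nat.choose_pos (Nat.lt_succ_iff.1 l.2)
    exact (le_mul_of_one_le_left (h.nonneg n l) h2).trans h1

lemma p2Feasible_nonempty (N K : ℕ) {M : ℝ} (hM : 0 ≤ M) : (p2Feasible N K M).Nonempty := by
  -- Nothing is cached.
  refine ⟨fun _ l => if l = 0 then 1 else 0, fun l n m _ => le_rfl, ⟨fun n => ?_, ?_, ?_⟩⟩
  · simp
  · simpa using hM
  · intro n l
    split_ifs <;> norm_num

lemma p2Value_isLeast {N : ℕ} (K : ℕ) (p : Fin N → ℝ) {M : ℝ} (hM : 0 ≤ M) :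
    IsLeast (avgRateLb p '' p2Feasible N K M) (p2Value K p M) :=
  ((p2Feasible_isCompact N K M).image (avgRateLb_continuous p)).isLeast_sInf
    ((p2Feasible_nonempty N K hM).image _)

/-! ### Optimality of the popularity order -/

lemma PopularityFirst.antitone {N K : ℕ} {a : Fin N → Fin (K + 1) → ℝ} (ha : PopularityFirst a)
    (l : Fin K) : Antitone fun n => a n l.succ := by
  cases N with
  | zero => exact fun i => i.elim0
  | succ N => exact Fin.antitone_iff_succ_le.2 fun i => ha l i.castSucc i.succ (by simp)

lemma orderedSum_le_rateLb {N K : ℕ} {a : Fin N → Fin (K + 1) → ℝ} (ha : PopularityFirst a)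
    (D : Finset (Fin N)) (π : Fin #D ≃ D) : orderedSum a D π ≤ rateLb a D := by
  let σ : Equiv.Perm (Fin #D) := π.trans (phi D).symm
  have hπ : ∀ i, π i = phi D (σ i) := fun i => by simp [σ]
  refine sum_le_sum fun l _ => ?_
  simp only [hπ]
  rcases Nat.eq_zero_or_pos (l : ℕ) with hl | hl
  -- At `l = 0` monotonicity of `a` is not assumed, but all coefficients are `1`, so the order is
  -- irrelevant.
  · simp only [hl, Nat.choose_zero_right, Nat.cast_one, one_mul]
    exact (Equiv.sum_comp σ fun i => a (phi D i) l.castSucc).le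
  · obtain ⟨l', hl'⟩ : ∃ l' : Fin K, l.castSucc = l'.succ :=
      ⟨⟨l - 1, by omega⟩, by ext; simp; omega⟩
    have hg : Antitone fun i => a (phi D i) l.castSucc := fun i j hij => by
      rw [hl']
      exact ha.antitone l' ((D.orderIsoOfFin rfl).monotone hij)
    have hf : Antitone fun i : Fin #D => ((K - ((i : ℕ) + 1)).choose l : ℝ) := fun i j hij => by
      have : (i : ℕ) ≤ j := hij
      exact Nat.cast_le.2 (Nat.choose_le_choose l (by omega))
    exact (hf.monovary hg).sum_mul_comp_perm_le_sum_mul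

lemma rateLbMax_eq_rateLb {N K : ℕ} {a : Fin N → Fin (K + 1) → ℝ} (ha : PopularityFirst a)
    (D : Finset (Fin N)) : rateLbMax a D = rateLb a D :=
  le_antisymm (sup'_le _ _ fun π _ => orderedSum_le_rateLb ha D π)
    (le_sup' (orderedSum a D) (mem_univ (phi D)))

end UncodedCaching

theorem lemma2 (N K : ℕ) (p : Fin N → ℝ) (hp0 : ∀ n, 0 ≤ p n) (hp1 : ∑ n, p n = 1)
    (hp : Antitone p) (M : ℝ) (hM : 0 ≤ M) :
    -- `φ` lists the files in decreasing order of popularity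
    (∀ D : Finset (Fin N), Antitone fun i => p (phi D i)) ∧
    -- for popularity-first placement vectors the maximum over all bijections is attained at `φ`
    (∀ a : Fin N → Fin (K + 1) → ℝ, PopularityFirst a →
      ∀ D : Finset (Fin N), D.card ≤ K → rateLbMax a D = rateLb a D) ∧
    -- the minimum in the problem P2 exists
    IsLeast (avgRateLb p '' p2Feasible N K M) (p2Value K p M) ∧
    -- it bounds the average rate of every error-free scheme with popularity-first placement,
    -- and so does the objective at the placement vector of the scheme
    (∀ F : ℕ, 0 < F → ∀ s : Scheme N K F, s.MeetsMemory M → PopularityFirst s.frac →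
      s.ZeroError →
        s.frac ∈ p2Feasible N K M ∧ avgRateLb p s.frac ≤ s.avgRate p ∧
          p2Value K p M ≤ s.avgRate p) ∧
    -- it bounds every average rate achievable with vanishing error probability
    (∀ R : ℝ, Achievable K p M R → p2Value K p M ≤ R) := by
  have hleast := p2Value_isLeast K p hM
  have hbound : ∀ F : ℕ, 0 < F → ∀ s : Scheme N K F, s.MeetsMemory M → PopularityFirst s.frac →
      (∀ d, s.errorProb d < 1 / 2) → s.frac ∈ p2Feasible N K M ∧
        avgRateLb p s.frac ≤ s.avgRate p ∧ p2Value K p M ≤ s.avgRate p := by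
    intro F hF s hs ha herr
    have hmem : s.frac ∈ p2Feasible N K M := ⟨ha, s.isPlacement_frac hF hM hs⟩
    have hle := s.avgRateLb_frac_le_avgRate hF herr hp0
    exact ⟨hmem, hle, (hleast.2 (Set.mem_image_of_mem _ hmem)).trans hle⟩
  refine ⟨fun D i j hij => hp ((D.orderIsoOfFin rfl).monotone hij),
    fun a ha D _ => rateLbMax_eq_rateLb ha D, hleast, ?_, ?_⟩
  · intro F hF s hs ha hzero
    refine hbound F hF s hs ha fun d => ?_
    have : s.errorProb d = 0 := by simp [Scheme.errorProb, hzero d]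
    rw [this]
    norm_num
  · intro R hR
    refine le_of_forall_pos_le_add fun ε hε => ?_
    -- The cap `1 / 4` keeps the error below the threshold `1 / 2`.
    obtain ⟨F, hF, s, hs, ha, herr, hrate⟩ := hR (min ε (1 / 4)) (by positivity)
    have h := hbound F hF s hs ha fun d =>
      ((herr d).trans (min_le_right _ _)).trans_lt (by norm_num)
    linarith [h.2.2, min_le_left ε (1 / 4)]
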